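/- All graphs are finite, simple and undirected. For a graph $H$ and an integer $k\ge 1$, the Token Sliding graph $\mathsf{TS}_k(H)$ has as vertices the $k$-cliques of $H$ (sets of $k$ pairwise adjacent vertices), two vertices $A,B$ being adjacent when $A\setminus B=\{u\}$ and $B\setminus A=\{v\}$ for some $u,v$ with $uv\in E(H)$. For a graph $G$, let $$\mathcal K^{\mathsf{TS}}(G)=\{k\ge 1:\ \mathsf{TS}_k(H)\cong G\text{ for some graph }H\}.$$ The Johnson graph $J(n,r)$ has as vertices the $r$-element subsets of $\{1,\dots,n\}$, two of them being adjacent when their intersection has size $r-1$. **Theorem.** Let $n\ge 2$ and $1\le r\le n-1$ be integers, and let $s=\min\{r,n-r\}$. Then $$\mathcal K^{\mathsf{TS}}(J(n,r))=\begin{cases}\{1\}, & n=2,\\ \{1,n-1\}, & n\ge 3\text{ and }s=1,\\ \{1,s\}, & s\ge 2\text{ and }n=2s,\\ \{1,s,n-s\}, & s\ge 2\text{ and }n>2s.\end{cases}$$ -/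

import Mathlib

/-- The Token Sliding reconfiguration graph `TS_k(H)`. Its vertices are the `k`-cliques of `H`; two
of them, `A` and `B`, are adjacent when `A \ B = {u}`, `B \ A = {v}` and `uv` is an edge of `H`. -/
def tokenSlidingGraph {W : Type*} [DecidableEq W] (k : ℕ) (H : SimpleGraph W) :
    SimpleGraph {A : Finset W // H.IsNClique k A} where
  Adj A B := ∃ u v : W, A.1 \ B.1 = {u} ∧ B.1 \ A.1 = {v} ∧ H.Adj u v
  symm := ⟨fun _ _ ⟨u, v, hu, hv, h⟩ => ⟨v, u, hv, hu, h.symm⟩⟩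
  loopless := ⟨fun A ⟨u, _, hu, _, _⟩ => by simp at hu⟩

/-- The Johnson graph `J(n, r)`. Its vertices are the `r`-subsets of an `n`-element set; two of them
are adjacent when they meet in exactly `r - 1` elements (written without truncated subtraction). -/
def johnsonGraph (n r : ℕ) : SimpleGraph {A : Finset (Fin n) // A.card = r} where
  Adj A B := (A.1 ∩ B.1).card + 1 = r
  symm := ⟨fun A B h => by rwa [Finset.inter_comm]⟩
  loopless := ⟨fun A h => by
    have hA := A.2
    simp only [Finset.inter_self] at h
    omega⟩

/-- The feasibility set `K^TS(G)`: all integers `k ≥ 1` such that `TS_k(H)` is isomorphic to `G` for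
some finite simple graph `H`. -/
def tokenSlidingLevels {V : Type*} (G : SimpleGraph V) : Set ℕ :=
  {k | 1 ≤ k ∧ ∃ (W : Type) (_ : Fintype W) (_ : DecidableEq W) (H : SimpleGraph W),
    Nonempty (tokenSlidingGraph k H ≃g G)}

namespace TokenSliding

open SimpleGraph Finset

/-! ### Finite sets of equal size at distance one -/

section Sets

variable {W : Type*} [DecidableEq W] {k : ℕ} {A B C Y : Finset W}

/-! Counting the vertices equal or adjacent to every vertex of a triangle recovers `k` from the
graph. An edge of `TS_k(H)` comes from a `(k + 1)`-clique `D` of `H`; if `k ≥ 2`, three `k`-subsets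
of `D` form a triangle with count exactly `k + 1` (`ncard_closedCommonNeighbors`). In `J(n, r)` a
triangle has count `r + 1` or `n - r + 1` (`ncard_closedCommonNeighbors_triangle`), so `k` is `r` or
`n - r`. Conversely, level 1 returns the graph itself, and complete graphs, with complementation,
realise `r` and `n - r`. -/

lemma card_union_eq_succ_iff (hA : A.card = k) (hB : B.card = k) :
    (A ∪ B).card = k + 1 ↔ (A ∩ B).card + 1 = k := by
  have := card_union_add_card_inter A B
  omega

lemma exists_inter_eq_erase (hY : Y.card = k) (hYA : (A ∪ Y).card ≤ k + 1)
    (hA : A.card = k) {x : W} (hx : x ∈ Y) (hxA : x ∉ A) : A ∩ Y = Y.erase x := by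
  have h1 := card_union_add_card_inter A Y
  apply eq_of_subset_of_card_le
  · intro z hz
    rw [mem_inter] at hz
    exact mem_erase.2 ⟨fun h => hxA (h ▸ hz.1), hz.2⟩
  · rw [card_erase_of_mem hx]
    omega

/-- A `k`-set close to both `A` and `B` with an element `x` outside `A ∪ B` is `A ∩ B` plus `x`. -/
lemma inter_subset_of_not_subset_union (hA : A.card = k) (hB : B.card = k) (hY : Y.card = k)
    (hAB : (A ∪ B).card = k + 1) (hAY : (A ∪ Y).card ≤ k + 1) (hBY : (B ∪ Y).card ≤ k + 1)
    {x : W} (hx : x ∈ Y) (hxAB : x ∉ A ∪ B) : A ∩ B = Y.erase x := by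
  rw [mem_union, not_or] at hxAB
  have h1 := exists_inter_eq_erase hY hAY hA hx hxAB.1
  have h2 := exists_inter_eq_erase hY hBY hB hx hxAB.2
  have h3 := (card_union_eq_succ_iff hA hB).1 hAB
  symm
  apply eq_of_subset_of_card_le
  · intro z hz
    exact mem_inter.2 ⟨(mem_inter.1 (h1 ▸ hz)).1, (mem_inter.1 (h2 ▸ hz)).1⟩
  · rw [card_erase_of_mem hx]
    omega

lemma eq_or_eq_of_inter_subset (hA : A.card = k) (hB : B.card = k) (hC : C.card = k)
    (hAB : (A ∪ B).card = k + 1) (hCAB : C ⊆ A ∪ B) (h : A ∩ B ⊆ C) : C = A ∨ C = B := by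
  have h3 := (card_union_eq_succ_iff hA hB).1 hAB
  obtain ⟨z, hzC, hz⟩ := exists_mem_notMem_of_card_lt_card (s := A ∩ B) (t := C) (by omega)
  have hins : insert z (A ∩ B) = C := by
    apply eq_of_subset_of_card_le (insert_subset hzC h)
    rw [card_insert_of_notMem hz]
    omega
  rcases mem_union.1 (hCAB hzC) with hzA | hzB
  · left
    refine eq_of_subset_of_card_le ?_ (by omega)
    rw [← hins]
    exact insert_subset hzA inter_subset_left
  · right
    refine eq_of_subset_of_card_le ?_ (by omega)
    rw [← hins]
    exact insert_subset hzB inter_subset_right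

end Sets

/-! ### An isomorphism invariant of triples of vertices -/

section Neighbors

variable {V V' : Type*}

/-- The vertices equal or adjacent to each of `a`, `b` and `c`. -/
def closedCommonNeighbors (G : SimpleGraph V) (a b c : V) : Set V :=
  {y | (y = a ∨ G.Adj a y) ∧ (y = b ∨ G.Adj b y) ∧ (y = c ∨ G.Adj c y)}

lemma ncard_closedCommonNeighbors_map {G : SimpleGraph V} {G' : SimpleGraph V'} (e : G ≃g G')
    (a b c : V) : (closedCommonNeighbors G' (e a) (e b) (e c)).ncard =
      (closedCommonNeighbors G a b c).ncard := by
  rw [← Set.ncard_image_of_injective _ e.injective]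
  congr 1
  ext y
  obtain ⟨y, rfl⟩ := e.surjective y
  rw [e.injective.mem_set_image]
  simp [closedCommonNeighbors, e.map_adj_iff]

end Neighbors

/-! ### Edges and triangles of token sliding graphs -/

section Adjacency

variable {W : Type*} [DecidableEq W] {k : ℕ} {H : SimpleGraph W}

/-- The edge `uv` of a slide is the only pair in `A ∪ B` that lies in neither clique. -/
lemma adj_iff_isNClique_union (A B : {A : Finset W // H.IsNClique k A}) :
    (tokenSlidingGraph k H).Adj A B ↔ H.IsNClique (k + 1) (A.1 ∪ B.1) := by
  have hA := A.2.card_eq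
  have hB := B.2.card_eq
  constructor
  · rintro ⟨u, v, hu, hv, huv⟩
    have hu' : ∀ x, x ∈ A.1 → x ∉ B.1 → x = u := fun x h1 h2 =>
      mem_singleton.1 (hu ▸ mem_sdiff.2 ⟨h1, h2⟩)
    have hv' : ∀ x, x ∈ B.1 → x ∉ A.1 → x = v := fun x h1 h2 =>
      mem_singleton.1 (hv ▸ mem_sdiff.2 ⟨h1, h2⟩)
    refine ⟨?_, ?_⟩
    · intro x hx y hy hxy
      simp only [coe_union, Set.mem_union, mem_coe] at hx hy
      by_cases hxA : x ∈ A.1 <;> by_cases hyA : y ∈ A.1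
      · exact A.2.isClique hxA hyA hxy
      · by_cases hxB : x ∈ B.1
        · exact B.2.isClique hxB (hy.resolve_left hyA) hxy
        · rw [hu' x hxA hxB, hv' y (hy.resolve_left hyA) hyA]
          exact huv
      · by_cases hyB : y ∈ B.1
        · exact B.2.isClique (hx.resolve_left hxA) hyB hxy
        · rw [hu' y hyA hyB, hv' x (hx.resolve_left hxA) hxA]
          exact huv.symm
      · exact B.2.isClique (hx.resolve_left hxA) (hy.resolve_left hyA) hxy
    · rw [card_union_eq_succ_iff hA hB]
      have h1 := card_sdiff_add_card_inter A.1 B.1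
      rw [hu, card_singleton] at h1
      omega
  · intro h
    have h1 := (card_union_eq_succ_iff hA hB).1 h.card_eq
    have h2 := card_sdiff_add_card_inter A.1 B.1
    have h3 := card_sdiff_add_card_inter B.1 A.1
    rw [inter_comm] at h3
    obtain ⟨u, hu⟩ := card_eq_one.1 (show (A.1 \ B.1).card = 1 by omega)
    obtain ⟨v, hv⟩ := card_eq_one.1 (show (B.1 \ A.1).card = 1 by omega)
    have hu' := mem_sdiff.1 (hu ▸ mem_singleton_self u)
    have hv' := mem_sdiff.1 (hv ▸ mem_singleton_self v)
    refine ⟨u, v, hu, hv, h.isClique ?_ ?_ ?_⟩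
    · exact mem_coe.2 (mem_union_left _ hu'.1)
    · exact mem_coe.2 (mem_union_right _ hv'.1)
    · rintro rfl
      exact hu'.2 hv'.1

lemma union_eq_of_ne {A B D : Finset W} (hA : A.card = k) (hB : B.card = k)
    (hD : D.card = k + 1) (hAD : A ⊆ D) (hBD : B ⊆ D) (hne : A ≠ B) : A ∪ B = D := by
  refine eq_of_subset_of_card_le (union_subset hAD hBD) ?_
  by_contra! hlt
  have h1 : A = A ∪ B := eq_of_subset_of_card_le subset_union_left (by omega)
  have h2 : B = A ∪ B := eq_of_subset_of_card_le subset_union_right (by omega)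
  exact hne (h1.trans h2.symm)

lemma adj_of_subset {A B : {A : Finset W // H.IsNClique k A}} {D : Finset W}
    (hD : H.IsNClique (k + 1) D) (hAD : A.1 ⊆ D) (hBD : B.1 ⊆ D) (hne : A ≠ B) :
    (tokenSlidingGraph k H).Adj A B := by
  rw [adj_iff_isNClique_union, union_eq_of_ne A.2.card_eq B.2.card_eq hD.card_eq hAD hBD
    (fun h => hne (Subtype.ext h))]
  exact hD

/-- Deleting a vertex from a `(k + 1)`-clique gives a `k`-clique. -/
def eraseClique {D : Finset W} (hD : H.IsNClique (k + 1) D) (x : D) :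
    {A : Finset W // H.IsNClique k A} :=
  ⟨D.erase x, hD.erase_of_mem x.2⟩

lemma eraseClique_injective {D : Finset W} (hD : H.IsNClique (k + 1) D) :
    Function.Injective (eraseClique hD) := by
  intro x y h
  exact Subtype.ext (erase_injOn D x.2 y.2 (congrArg Subtype.val h))

lemma range_eraseClique {D : Finset W} (hD : H.IsNClique (k + 1) D) :
    Set.range (eraseClique hD) = {A | A.1 ⊆ D} := by
  ext A
  constructor
  · rintro ⟨x, rfl⟩
    exact erase_subset _ _
  · intro hA
    have hA : A.1 ⊆ D := hA
    have h1 := A.2.card_eq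
    have h2 := hD.card_eq
    obtain ⟨x, hx, hxA⟩ := exists_mem_notMem_of_card_lt_card (s := A.1) (t := D) (by omega)
    refine ⟨⟨x, hx⟩, Subtype.ext ?_⟩
    symm
    refine eq_of_subset_of_card_le (fun z hz => mem_erase.2 ⟨?_, hA hz⟩) ?_
    · rintro rfl
      exact hxA hz
    · change (D.erase x).card ≤ A.1.card
      rw [card_erase_of_mem hx]
      omega

lemma ncard_cliques_subset {D : Finset W} (hD : H.IsNClique (k + 1) D) :
    {A : {A : Finset W // H.IsNClique k A} | A.1 ⊆ D}.ncard = k + 1 := by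
  rw [← range_eraseClique hD, ← Set.image_univ,
    Set.ncard_image_of_injective _ (eraseClique_injective hD), Set.ncard_univ,
    Nat.card_eq_fintype_card, Fintype.card_coe, hD.card_eq]

lemma adj_eraseClique {D : Finset W} (hD : H.IsNClique (k + 1) D) {x y : D} (h : x ≠ y) :
    (tokenSlidingGraph k H).Adj (eraseClique hD x) (eraseClique hD y) :=
  adj_of_subset hD (erase_subset _ _) (erase_subset _ _) ((eraseClique_injective hD).ne h)

/-- The vertices counted are exactly the `k`-subsets of `A ∪ B`: one with a point outside would
force `A ∩ B ⊆ C`, leaving only `C = A` or `C = B`. -/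
lemma ncard_closedCommonNeighbors {A B C : {A : Finset W // H.IsNClique k A}}
    (hAB : (tokenSlidingGraph k H).Adj A B) (hCA : C ≠ A) (hCB : C ≠ B)
    (hC : C.1 ⊆ A.1 ∪ B.1) :
    (closedCommonNeighbors (tokenSlidingGraph k H) A B C).ncard = k + 1 := by
  have hD := (adj_iff_isNClique_union A B).1 hAB
  rw [← ncard_cliques_subset hD]
  congr 1
  ext Y
  have close : ∀ Z : {A : Finset W // H.IsNClique k A},
      (Y = Z ∨ (tokenSlidingGraph k H).Adj Z Y) → (Z.1 ∪ Y.1).card ≤ k + 1 := by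
    rintro Z (rfl | h)
    · rw [union_self, Y.2.card_eq]
      omega
    · exact ((adj_iff_isNClique_union Z Y).1 h).card_eq.le
  constructor
  · rintro ⟨hYA, hYB, hYC⟩ x hx
    by_contra hxD
    have h1 := inter_subset_of_not_subset_union A.2.card_eq B.2.card_eq Y.2.card_eq hD.card_eq
      (close A hYA) (close B hYB) hx hxD
    have h2 := exists_inter_eq_erase Y.2.card_eq (close C hYC) C.2.card_eq hx
      (fun h => hxD (hC h))
    -- Both `A ∩ B` and `C ∩ Y` equal `Y.erase x`.
    rcases eq_or_eq_of_inter_subset A.2.card_eq B.2.card_eq C.2.card_eq hD.card_eq hC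
      (by rw [h1, ← h2]; exact inter_subset_left) with h | h
    · exact hCA (Subtype.ext h)
    · exact hCB (Subtype.ext h)
  · intro hY
    have key : ∀ Z : {A : Finset W // H.IsNClique k A}, Z.1 ⊆ A.1 ∪ B.1 →
        Y = Z ∨ (tokenSlidingGraph k H).Adj Z Y := by
      intro Z hZ
      by_cases h : Y = Z
      · exact Or.inl h
      · exact Or.inr (adj_of_subset hD hZ hY (Ne.symm h))
    exact ⟨key A subset_union_left, key B subset_union_right, key C hC⟩

/-- The token sliding graph at level one is the graph itself. -/
noncomputable def tokenSlidingOneIso (H : SimpleGraph W) : H ≃g tokenSlidingGraph 1 H where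
  toEquiv := Equiv.ofBijective (fun v => ⟨{v}, by simp⟩) (by
    constructor
    · intro v w h
      exact singleton_injective (congrArg Subtype.val h)
    · rintro ⟨A, hA⟩
      obtain ⟨v, rfl⟩ := isNClique_one.1 hA
      exact ⟨v, rfl⟩)
  map_rel_iff' := by
    intro v w
    constructor
    · rintro ⟨x, y, hx, hy, hxy⟩
      have h1 : x ∈ ({v} : Finset W) := (mem_sdiff.1 (hx ▸ mem_singleton_self x)).1
      have h2 : y ∈ ({w} : Finset W) := (mem_sdiff.1 (hy ▸ mem_singleton_self y)).1
      rw [mem_singleton] at h1 h2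
      rwa [h1, h2] at hxy
    · intro h
      refine ⟨v, w, ?_, ?_, h⟩
      · exact sdiff_eq_self_of_disjoint (disjoint_singleton.2 h.ne)
      · exact sdiff_eq_self_of_disjoint (disjoint_singleton.2 h.ne.symm)

end Adjacency

/-! ### Johnson graphs and their levels -/

section Johnson

variable {n r : ℕ}

lemma isNClique_top_iff_card {W : Type*} {k : ℕ} (A : Finset W) :
    (⊤ : SimpleGraph W).IsNClique k A ↔ A.card = k :=
  ⟨fun h => h.card_eq, fun h => ⟨fun _ _ _ _ hne => hne, h⟩⟩

lemma johnsonGraph_adj_iff (A B : {A : Finset (Fin n) // A.card = r}) :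
    (johnsonGraph n r).Adj A B ↔ (A.1 ∪ B.1).card = r + 1 :=
  (card_union_eq_succ_iff A.2 B.2).symm

/-- The Johnson graph is the token sliding graph of the complete graph. -/
def tokenSlidingTopIso (n r : ℕ) :
    tokenSlidingGraph r (⊤ : SimpleGraph (Fin n)) ≃g johnsonGraph n r where
  toEquiv := Equiv.subtypeEquivRight isNClique_top_iff_card
  map_rel_iff' := by
    intro A B
    rw [johnsonGraph_adj_iff, adj_iff_isNClique_union, isNClique_top_iff_card]
    rfl

/-- Complementation identifies `J(n, r)` with `J(n, n - r)`. -/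
def complIso (h : r ≤ n) : johnsonGraph n (n - r) ≃g johnsonGraph n r where
  toFun A := ⟨A.1ᶜ, by rw [card_compl, A.2, Fintype.card_fin]; omega⟩
  invFun A := ⟨A.1ᶜ, by rw [card_compl, A.2, Fintype.card_fin]⟩
  left_inv A := Subtype.ext (compl_compl _)
  right_inv A := Subtype.ext (compl_compl _)
  map_rel_iff' := by
    intro A B
    have h1 := card_union_add_card_inter A.1 B.1
    have h2 := card_compl (A.1 ∪ B.1)
    have h3 := card_le_univ (A.1 ∪ B.1)
    rw [compl_union] at h2
    rw [Fintype.card_fin] at h2 h3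
    have hA := A.2
    have hB := B.2
    change (A.1ᶜ ∩ B.1ᶜ).card + 1 = r ↔ (A.1 ∩ B.1).card + 1 = n - r
    omega

lemma ncard_closedCommonNeighbors_johnson {A B C : {A : Finset (Fin n) // A.card = r}}
    (hAB : (johnsonGraph n r).Adj A B) (hCA : C ≠ A) (hCB : C ≠ B) (hC : C.1 ⊆ A.1 ∪ B.1) :
    (closedCommonNeighbors (johnsonGraph n r) A B C).ncard = r + 1 := by
  let e := (tokenSlidingTopIso n r).symm
  rw [← ncard_closedCommonNeighbors_map e]
  exact ncard_closedCommonNeighbors (e.map_adj_iff.2 hAB) (e.injective.ne hCA)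
    (e.injective.ne hCB) hC

/-- If `C` leaves `A ∪ B`, it contains `A ∩ B`; complements turn this into `Cᶜ ⊆ Aᶜ ∪ Bᶜ`, the first
case in `J(n, n - r)`. -/
lemma ncard_closedCommonNeighbors_triangle (hrn : r ≤ n)
    {A B C : {A : Finset (Fin n) // A.card = r}} (hAB : (johnsonGraph n r).Adj A B)
    (hAC : (johnsonGraph n r).Adj A C) (hBC : (johnsonGraph n r).Adj B C) :
    (closedCommonNeighbors (johnsonGraph n r) A B C).ncard = r + 1 ∨
      (closedCommonNeighbors (johnsonGraph n r) A B C).ncard = n - r + 1 := by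
  by_cases hC : C.1 ⊆ A.1 ∪ B.1
  · exact Or.inl (ncard_closedCommonNeighbors_johnson hAB hAC.ne.symm hBC.ne.symm hC)
  · right
    obtain ⟨x, hx, hxD⟩ := not_subset.1 hC
    rw [johnsonGraph_adj_iff] at hAC hBC
    have h1 := inter_subset_of_not_subset_union A.2 B.2 C.2 ((johnsonGraph_adj_iff A B).1 hAB)
      hAC.le hBC.le hx hxD
    rw [← johnsonGraph_adj_iff] at hAC hBC
    let e := (complIso hrn).symm
    rw [← ncard_closedCommonNeighbors_map e]
    refine ncard_closedCommonNeighbors_johnson (e.map_adj_iff.2 hAB)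
      (e.injective.ne hAC.ne.symm) (e.injective.ne hBC.ne.symm) ?_
    change C.1ᶜ ⊆ A.1ᶜ ∪ B.1ᶜ
    rw [← compl_inter, compl_subset_compl, h1]
    exact erase_subset _ _

lemma exists_johnsonGraph_adj (hr : 1 ≤ r) (hrn : r < n) :
    ∃ A B, (johnsonGraph n r).Adj A B := by
  obtain ⟨D, -, hD⟩ := exists_subset_card_eq (s := (univ : Finset (Fin n))) (n := r + 1)
    (by rw [card_univ, Fintype.card_fin]; omega)
  obtain ⟨a, ha, b, hb, hab⟩ := one_lt_card.1 (show 1 < D.card by omega)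
  have hD' := (isNClique_top_iff_card D).2 hD
  exact ⟨_, _, (tokenSlidingTopIso n r).map_adj_iff.2
    (adj_eraseClique hD' (x := ⟨a, ha⟩) (y := ⟨b, hb⟩) (fun h => hab (congrArg Subtype.val h)))⟩

lemma eq_or_eq_of_tokenSlidingIso {W : Type*} [DecidableEq W] {H : SimpleGraph W} {k : ℕ}
    (hk : 2 ≤ k) (hr : 1 ≤ r) (hrn : r < n) (e : tokenSlidingGraph k H ≃g johnsonGraph n r) :
    k = r ∨ k = n - r := by
  obtain ⟨A, B, hAB⟩ := exists_johnsonGraph_adj hr hrn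
  have hD := (adj_iff_isNClique_union _ _).1 (e.symm.map_adj_iff.2 hAB)
  have hcard := hD.card_eq
  -- Here `2 ≤ k` is essential: the clique has `k + 1 ≥ 3` points, and erasing three of them in turn
  -- gives a triangle.
  obtain ⟨a, b, c, ha, hb, hc, hab, hac, hbc⟩ := two_lt_card_iff.1
    (show 2 < ((e.symm A).1 ∪ (e.symm B).1).card by omega)
  have hadj : ∀ {x y} (hx : x ∈ (e.symm A).1 ∪ (e.symm B).1)
      (hy : y ∈ (e.symm A).1 ∪ (e.symm B).1), x ≠ y →
      (tokenSlidingGraph k H).Adj (eraseClique hD ⟨x, hx⟩) (eraseClique hD ⟨y, hy⟩) :=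
    fun hx hy h => adj_eraseClique hD (fun h' => h (congrArg Subtype.val h'))
  have hadj1 := hadj ha hb hab
  have hadj2 := hadj ha hc hac
  have hadj3 := hadj hb hc hbc
  have hcount := ncard_closedCommonNeighbors hadj1 hadj2.ne.symm hadj3.ne.symm (by
    rw [union_eq_of_ne (eraseClique hD ⟨a, ha⟩).2.card_eq (eraseClique hD ⟨b, hb⟩).2.card_eq
      hcard (erase_subset _ _) (erase_subset _ _) (fun h => hadj1.ne (Subtype.ext h))]
    exact erase_subset _ _)
  rw [← ncard_closedCommonNeighbors_map e] at hcount
  have := ncard_closedCommonNeighbors_triangle hrn.le (e.map_adj_iff.2 hadj1)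
    (e.map_adj_iff.2 hadj2) (e.map_adj_iff.2 hadj3)
  omega

theorem tokenSlidingLevels_johnsonGraph (hr : 1 ≤ r) (hrn : r < n) :
    tokenSlidingLevels (johnsonGraph n r) = {1, r, n - r} := by
  ext k
  constructor
  · rintro ⟨hk, W, _, _, H, ⟨e⟩⟩
    rcases hk.eq_or_lt with h | h
    · exact Or.inl h.symm
    · exact Or.inr (eq_or_eq_of_tokenSlidingIso h hr hrn e)
  · rintro (rfl | rfl | rfl)
    · exact ⟨le_rfl, _, inferInstance, inferInstance, _, ⟨(tokenSlidingOneIso _).symm⟩⟩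
    · exact ⟨hr, Fin n, inferInstance, inferInstance, ⊤, ⟨tokenSlidingTopIso n k⟩⟩
    · exact ⟨by omega, Fin n, inferInstance, inferInstance, ⊤,
        ⟨(tokenSlidingTopIso n (n - r)).trans (complIso hrn.le)⟩⟩

end Johnson

end TokenSliding

theorem mainTheorem1 (n r s : ℕ) (hn : 2 ≤ n) (hr : 1 ≤ r) (hrn : r < n)
    (hs : s = min r (n - r)) :
    (n = 2 → tokenSlidingLevels (johnsonGraph n r) = {1}) ∧
    (3 ≤ n → s = 1 → tokenSlidingLevels (johnsonGraph n r) = {1, n - 1}) ∧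
    (2 ≤ s → n = 2 * s → tokenSlidingLevels (johnsonGraph n r) = {1, s}) ∧
    (2 ≤ s → 2 * s < n → tokenSlidingLevels (johnsonGraph n r) = {1, s, n - s}) := by
  rw [TokenSliding.tokenSlidingLevels_johnsonGraph hr hrn]
  -- `s` and `n - s` are `r` and `n - r` in some order; the four cases record which elements of `{1,
  -- r, n - r}` coincide.
  refine ⟨?_, ?_, ?_, ?_⟩ <;> intros <;> ext k <;>
    simp only [Set.mem_insert_iff, Set.mem_singleton_iff] <;> omega
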